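/- For a finite graph $G$ and an integer $k \ge 0$, let $\Delta(G)$ be its clique complex (the faces are the cliques of $G$), let $d_k(G)$ be the number of $k$-faces of $\Delta(G)$, i.e. of cliques of $G$ with $k+1$ vertices, and let $\beta_k(G) = \dim_{\mathbb{Z}_2} \ker \partial_k / \operatorname{im} \partial_{k+1}$ be its $k$-th (unreduced, $\partial_0 = 0$) Betti number over $\mathbb{Z}_2$. The distance of two $n$-vertex graphs $G, G'$ is $D(G,G') = \min_\pi |E(G) \mathbin{\triangle} E(\pi(G'))| / n^2$, where $\pi$ ranges over the permutations of the vertices; $G$ is $\varepsilon$-far from a graph property $P$ if $D(G,G') > \varepsilon$ for all $n$-vertex graphs $G'$ with the property $P$. The property $P$ is testable with distance parameter $\varepsilon$ (in the dense graph model) if there are a number $q$, independent of the size of the graph, and a randomised algorithm that is given the number $n$ of vertices and query access to the adjacency matrix of a graph $G$, makes at most $q$ queries, returns YES with probability at least $2/3$ if $G$ has the property $P$, and returns NO with probability at least $2/3$ if $G$ is $\varepsilon$-far from $P$. **Theorem.** For every integer $k \ge 0$ and every real $\varepsilon > 0$ there exists $\delta(\varepsilon,k) > 0$ such that for every real $\delta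 \le \delta(\varepsilon,k)$ the graph property $\beta_k(G) \ge (1-\delta)\, d_k(G)$ is testable with distance parameter $\varepsilon$. -/

import Mathlib

namespace BettiTesting

/-! ### Simplicial homology with coefficients in `ZMod 2` -/

/-- The set `F_k` of `k`-faces: the faces with exactly `k + 1` vertices. -/
def kFaces {V : Type*} (Δ : AbstractSimplicialComplex V) (k : ℕ) : Set (Finset V) :=
  {S | S ∈ Δ ∧ S.card = k + 1}

/-- The number `d_k` of `k`-faces. -/
noncomputable def numFaces {V : Type*} (Δ : AbstractSimplicialComplex V) (k : ℕ) : ℕ :=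
  (kFaces Δ k).ncard

noncomputable instance {V : Type*} [Finite V] (Δ : AbstractSimplicialComplex V) (k : ℕ) :
    Fintype (kFaces Δ k) :=
  Fintype.ofFinite _

/-- The `k`-th chain group `C_k` over `ZMod 2` of a complex on a finite vertex set: formal sums of
`k`-faces, given by their coefficient vectors. -/
abbrev Chain.{u} {V : Type u} (Δ : AbstractSimplicialComplex V) (k : ℕ) : Type u :=
  kFaces Δ k → ZMod 2

theorem erase_mem_kFaces {V : Type*} [DecidableEq V] (Δ : AbstractSimplicialComplex V) (k : ℕ)
    {S : Finset V} (hS : S ∈ kFaces Δ (k + 1)) {v : V} (hv : v ∈ S) :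
    S.erase v ∈ kFaces Δ k := by
  obtain ⟨hmem, hcard⟩ := hS
  have hc : (S.erase v).card = k + 1 := by
    rw [Finset.card_erase_of_mem hv, hcard]
    rfl
  refine ⟨?_, hc⟩
  have hne : (S.erase v).Nonempty := Finset.card_pos.mp (by omega)
  exact (Δ.isRelLowerSet_faces hmem).2 (Finset.erase_subset v S) hne

/-- The boundary operator `C_{k+1} → C_k`: the linear map that sends a `(k+1)`-face `S` to the sum
of the `k`-faces `S \ {v}`, `v ∈ S`. -/
noncomputable def boundary {V : Type*} [Finite V] [DecidableEq V] (Δ : AbstractSimplicialComplex V)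
    (k : ℕ) : Chain Δ (k + 1) →ₗ[ZMod 2] Chain Δ k :=
  Fintype.linearCombination (ZMod 2) fun S : kFaces Δ (k + 1) =>
    ∑ v : {v // v ∈ S.1},
      (Pi.single ⟨S.1.erase v.1, erase_mem_kFaces Δ k S.2 v.2⟩ 1 : Chain Δ k)

/-- The kernel of the `k`-th boundary operator; the boundary of a `0`-chain is zero. -/
noncomputable def cycles {V : Type*} [Finite V] [DecidableEq V] (Δ : AbstractSimplicialComplex V) :
    (k : ℕ) → Submodule (ZMod 2) (Chain Δ k)
  | 0 => ⊤
  | k + 1 => LinearMap.ker (boundary Δ k)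

/-- The image of the `(k+1)`-st boundary operator. -/
noncomputable def boundaries {V : Type*} [Finite V] [DecidableEq V]
    (Δ : AbstractSimplicialComplex V) (k : ℕ) : Submodule (ZMod 2) (Chain Δ k) :=
  LinearMap.range (boundary Δ k)

/-- The `k`-th homology group over `ZMod 2`: cycles modulo boundaries. -/
abbrev Homology.{u} {V : Type u} [Finite V] [DecidableEq V]
    (Δ : AbstractSimplicialComplex V) (k : ℕ) : Type u :=
  cycles Δ k ⧸ (boundaries Δ k).submoduleOf (cycles Δ k)

/-- The `k`-th Betti number over `ZMod 2`. -/
noncomputable def betti {V : Type*} [Finite V] [DecidableEq V]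
    (Δ : AbstractSimplicialComplex V) (k : ℕ) : ℕ :=
  Module.finrank (ZMod 2) (Homology Δ k)

/-- The clique complex of a graph: its faces are the nonempty finite cliques. -/
def cliqueComplex {V : Type*} (G : SimpleGraph V) : AbstractSimplicialComplex V where
  faces := {S | S.Nonempty ∧ G.IsClique (S : Set V)}
  isRelLowerSet_faces := fun {_} hS =>
    ⟨hS.1, fun _ hTS hT => ⟨hT, hS.2.subset (Finset.coe_subset.mpr hTS)⟩⟩
  singleton_mem := fun v => ⟨Finset.singleton_nonempty v, by simp⟩

/-! ### Property testing in the dense graph model -/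

/-- A property of finite graphs, on the vertex sets `Fin n`. -/
abbrev GraphProperty : Type := (n : ℕ) → SimpleGraph (Fin n) → Prop

/-- The distance of two graphs on `n` vertices: the least size of the symmetric difference of the
edge sets of `G` and of a relabelling of `G'`, divided by `n ^ 2`. -/
noncomputable def graphDist {n : ℕ} (G G' : SimpleGraph (Fin n)) : ℝ :=
  ((⨅ π : Equiv.Perm (Fin n),
    (symmDiff G.edgeSet (G'.map π.toEmbedding).edgeSet).ncard : ℕ) : ℝ) / (n : ℝ) ^ 2

/-- `G` is `ε`-far from the property `P`: its distance to every graph with the property, on the same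
number of vertices, exceeds `ε`. -/
def IsFar (P : GraphProperty) (ε : ℝ) {n : ℕ} (G : SimpleGraph (Fin n)) : Prop :=
  ∀ G' : SimpleGraph (Fin n), P n G' → ε < graphDist G G'

open Classical in
/-- The entry `(u, v)` of the adjacency matrix of `G`; it is `false` outside the matrix. -/
noncomputable def adjEntry {n : ℕ} (G : SimpleGraph (Fin n)) (u v : ℕ) : Bool :=
  decide (∃ (hu : u < n) (hv : v < n), G.Adj ⟨u, hu⟩ ⟨v, hv⟩)

/-- A randomised algorithm with query access to an adjacency matrix. It is given the number `n` of
vertices and a random seed `r`, uniformly distributed on `{0, …, numSeeds n - 1}`. From `n`, `r` and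
the list of the answers received so far (oldest first) it computes its next step: either a pair
`(u, v)`, to query the entry `(u, v)` of the adjacency matrix, or a Boolean, to stop with that output
(`true` is YES and `false` is NO). -/
structure QueryAlgorithm where
  /-- the number of random seeds, as a function of the number of vertices -/
  numSeeds : ℕ → ℕ
  numSeeds_pos : ∀ n, 0 < numSeeds n
  numSeeds_computable : Computable numSeeds
  /-- the next step, from the number of vertices, the seed and the answers so far -/
  next : ℕ → ℕ → List Bool → (ℕ × ℕ) ⊕ Bool
  next_computable : Computable fun x : ℕ × ℕ × List Bool => next x.1 x.2.1 x.2.2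

namespace QueryAlgorithm

/-- The output of the algorithm on the graph `G` with the seed `r`, continuing from the list `h` of
answers with at most `q` further queries; `none` if it wants to make more queries than that. -/
noncomputable def runFrom (A : QueryAlgorithm) {n : ℕ} (G : SimpleGraph (Fin n)) (r : ℕ) :
    ℕ → List Bool → Option Bool
  | 0, h => match A.next n r h with
    | Sum.inr b => some b
    | Sum.inl _ => none
  | q + 1, h => match A.next n r h with
    | Sum.inr b => some b
    | Sum.inl (u, v) => A.runFrom G r q (h ++ [adjEntry G u v])

/-- The output of the algorithm on the graph `G` with the seed `r`, if it makes at most `q`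
queries. -/
noncomputable def run (A : QueryAlgorithm) (q : ℕ) {n : ℕ} (G : SimpleGraph (Fin n)) (r : ℕ) :
    Option Bool :=
  A.runFrom G r q []

/-- On every graph and with every seed the algorithm stops after at most `q` queries. -/
def MakesAtMost (A : QueryAlgorithm) (q : ℕ) : Prop :=
  ∀ (n : ℕ) (G : SimpleGraph (Fin n)), ∀ r < A.numSeeds n, (A.run q G r).isSome

/-- The probability, over the random seed, that the algorithm, allowed `q` queries, outputs `b`. -/
noncomputable def probOutput (A : QueryAlgorithm) (q : ℕ) {n : ℕ} (G : SimpleGraph (Fin n))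
    (b : Bool) : ℝ :=
  (((Finset.range (A.numSeeds n)).filter fun r => A.run q G r = some b).card : ℝ) / A.numSeeds n

end QueryAlgorithm

/-- The property `P` is testable with distance parameter `ε`: for some number `q` of queries, the
same for graphs of all sizes, there is an algorithm that makes at most `q` queries, outputs YES with
probability at least `2/3` on every graph with the property, and outputs NO with probability at
least `2/3` on every graph that is `ε`-far from it. -/
def IsTestable (P : GraphProperty) (ε : ℝ) : Prop :=
  ∃ (q : ℕ) (A : QueryAlgorithm), A.MakesAtMost q ∧
    ∀ (n : ℕ) (G : SimpleGraph (Fin n)),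
      (P n G → 2 / 3 ≤ A.probOutput q G true) ∧
      (IsFar P ε G → 2 / 3 ≤ A.probOutput q G false)

/-- The graph property `β_k ≥ (1 - δ) d_k` of the clique complex. -/
def LargeBetti (k : ℕ) (δ : ℝ) : GraphProperty := fun _ G =>
  (1 - δ) * (numFaces (cliqueComplex G) k : ℝ) ≤ (betti (cliqueComplex G) k : ℝ)

end BettiTesting

/-!
The boundaries of the `(k + 1)`-faces through a fixed vertex `v` are linearly independent, since
`S \ {v}` occurs in the boundary of `S` only. Hence `d_{k+1}` is at most the number `n` of vertices
times the rank of the boundary operator `C_{k+1} → C_k` (`numFaces_succ_le`). As `β_k` plus that rank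
is at most `d_k ≤ n ^ (k + 1)`, the property `β_k ≥ (1 - δ) d_k` with `δ > 0` implies
`d_{k+1} ≤ δ n ^ (k + 2)`: the density of cliques with `k + 2` vertices is `O(δ)`
(`card_cliqueTuples_le_of_largeBetti`).

Conversely, let `G` have a sufficiently small density of such cliques. By the clique removal lemma
(`clique_removal`, obtained from Szemerédi's regularity lemma and the counting lemma
`exists_counting`) few edges can be deleted to get rid of all of them. In the resulting graph nothing
is a `k`-boundary, so `β_k ≥ d_k - d_{k-1} ≥ d_k - n ^ k`. This is at least `(1 - δ) d_k` unless
`d_k < n ^ k / δ`, and in that case, for large `n`, the removal lemma lets us delete all `k`-faces as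
well, after which the property holds trivially. So `G` is not `ε`-far from the property, and graphs
that are far have clique density at least some `c` that depends on `ε` and `k` only
(`exists_le_card_cliqueTuples_of_isFar`).

The tester samples `m` tuples of `k + 2` vertices and says NO if one of them is a clique. The number
`m` is chosen such that a density of at least `c` is detected with probability `2 / 3`, and then `δ₀`
so small that on graphs with the property no clique is found with probability `2 / 3`. Graphs with
fewer vertices than a bound that depends on `δ`, `ε` and `k` are read completely and looked up in a
finite table (`isTestable_of_cliqueTuples`).

For `δ < 0` the property means that there are no `k`-faces, and for `δ = 0` that there are no `k`-faces
if `k > 0` and no edges if `k = 0`. The absence of cliques of a given size is tested in the same way.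
-/

namespace BettiTesting

open Finset

/-! ### Counting cliques in regular tuples of vertex sets -/

open Classical in
/-- The labelled cliques with `r` vertices: the `r`-tuples of pairwise adjacent vertices. The entries
are automatically distinct, so each clique is counted `r!` times. -/
noncomputable def cliqueTuples {V : Type*} [Fintype V] (G : SimpleGraph V) (r : ℕ) :
    Finset (Fin r → V) :=
  {f | Pairwise fun i j => G.Adj (f i) (f j)}

@[simp] theorem mem_cliqueTuples {V : Type*} [Fintype V] {G : SimpleGraph V} {r : ℕ}
    {f : Fin r → V} : f ∈ cliqueTuples G r ↔ Pairwise fun i j => G.Adj (f i) (f j) := by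
  simp [cliqueTuples]

open Classical in
/-- The one-sided form of `η`-regularity that survives passing to large subsets: large subsets of
`A` and `B` span edges of density at least `d`. -/
def LowerRegular {V : Type*} (G : SimpleGraph V) (η d : ℝ) (A B : Finset V) : Prop :=
  ∀ X ⊆ A, ∀ Y ⊆ B, η * #A ≤ #X → η * #B ≤ #Y → d * (#X * #Y) ≤ #(G.interedges X Y)

open Classical in
theorem LowerRegular.subset {V : Type*} {G : SimpleGraph V} {η η' d : ℝ} {A B A' B' : Finset V}
    (h : LowerRegular G η' d A B) (hη : 0 ≤ η) (hηd : η' ≤ d * η) (hA : A' ⊆ A) (hB : B' ⊆ B)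
    (hA' : d * #A ≤ #A') (hB' : d * #B ≤ #B') : LowerRegular G η d A' B' := by
  intro X hX Y hY hXc hYc
  have key : ∀ S S' : Finset V, d * #S ≤ #S' → η' * #S ≤ η * #S' := fun S S' hS =>
    calc η' * #S ≤ d * η * #S := by gcongr
      _ = η * (d * #S) := by ring
      _ ≤ η * #S' := by gcongr
  exact h X (hX.trans hA) Y (hY.trans hB) ((key _ _ hA').trans hXc) ((key _ _ hB').trans hYc)

open Classical in
/-- In a lower regular pair only few vertices of `A` have few neighbours in `B`. -/
theorem LowerRegular.card_lowDegree_le {V : Type*} {G : SimpleGraph V} {η d : ℝ} {A B : Finset V}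
    (h : LowerRegular G η d A B) (hη : 0 ≤ η) (hη' : η ≤ 1) :
    (#{v ∈ A | (#{w ∈ B | G.Adj v w} : ℝ) < d * #B} : ℝ) ≤ η * #A := by
  by_contra! hlt
  set X := {v ∈ A | (#{w ∈ B | G.Adj v w} : ℝ) < d * #B} with hX
  have hXne : X.Nonempty := by
    rw [← card_pos]
    have : (0 : ℝ) < #X := lt_of_le_of_lt (by positivity) hlt
    exact_mod_cast this
  have h1 := h X (filter_subset _ _) B Subset.rfl hlt.le
    (mul_le_of_le_one_left (by positivity) hη')
  have h2 : (#(G.interedges X B) : ℝ) = ∑ v ∈ X, (#{w ∈ B | G.Adj v w} : ℝ) := by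
    rw [SimpleGraph.interedges_def, card_filter, sum_product]
    push_cast
    refine sum_congr rfl fun v _ => ?_
    rw [card_filter]
    push_cast
    rfl
  have h3 : ∑ v ∈ X, (#{w ∈ B | G.Adj v w} : ℝ) < ∑ v ∈ X, d * #B :=
    sum_lt_sum_of_nonempty hXne fun v hv => (mem_filter.1 hv).2
  rw [sum_const, nsmul_eq_mul] at h3
  linarith [mul_left_comm d (#X : ℝ) (#B : ℝ)]

open Classical in
/-- Labelled `(r + 1)`-cliques, sorted by their first vertex. -/
theorem sum_card_cliqueTuples_le {V : Type*} [Fintype V] (G : SimpleGraph V) {r : ℕ}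
    (A : Fin (r + 1) → Finset V) {S : Finset V} (hS : S ⊆ A 0) :
    ∑ v ∈ S, #{f ∈ cliqueTuples G r | ∀ i, f i ∈ {w ∈ A i.succ | G.Adj v w}} ≤
      #{f ∈ cliqueTuples G (r + 1) | ∀ i, f i ∈ A i} := by
  rw [← card_sigma]
  refine card_le_card_of_injOn (fun p => Fin.cons p.1 p.2) ?_ ?_
  · rintro ⟨v, f⟩ hvf
    simp only [coe_sigma, Set.mem_sigma_iff, mem_coe, mem_filter, mem_cliqueTuples] at hvf
    obtain ⟨hv, hf, hfB⟩ := hvf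
    simp only [mem_coe, mem_filter, mem_cliqueTuples]
    refine ⟨fun i j hij => ?_, fun i => ?_⟩
    · induction i using Fin.cases with
      | zero =>
        induction j using Fin.cases with
        | zero => exact absurd rfl hij
        | succ j => simpa using (hfB j).2
      | succ i =>
        induction j using Fin.cases with
        | zero => simpa using (hfB i).2.symm
        | succ j => simpa using hf (fun h => hij (congrArg Fin.succ h))
    · induction i using Fin.cases with
      | zero => exact hS hv
      | succ i => exact (hfB i).1
  · rintro ⟨v, f⟩ _ ⟨v', f'⟩ _ h
    obtain ⟨rfl, rfl⟩ := Fin.cons_inj.1 h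
    rfl

open Classical in
/-- The counting lemma for cliques. The first vertex is chosen among those with many neighbours in
all other sets, and the remaining ones are found in its neighbourhoods. -/
theorem exists_counting {d : ℝ} (hd : 0 < d) (r : ℕ) :
    ∃ η : ℝ, 0 < η ∧ ∃ c : ℝ, 0 < c ∧ ∀ {V : Type*} [Fintype V] (G : SimpleGraph V)
      (A : Fin r → Finset V), (∀ i j, i < j → LowerRegular G η d (A i) (A j)) →
      c * ∏ i, (#(A i) : ℝ) ≤ #{f ∈ cliqueTuples G r | ∀ i, f i ∈ A i} := by
  induction r with
  | zero =>
    refine ⟨1, one_pos, 1, one_pos, fun {V} _ G A _ => ?_⟩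
    have : {f ∈ cliqueTuples G 0 | ∀ i, f i ∈ A i} = univ := by
      ext f
      simp only [mem_filter, mem_cliqueTuples, mem_univ, iff_true]
      exact ⟨fun i => i.elim0, fun i => i.elim0⟩
    rw [this, card_univ]
    simp
  | succ r ih =>
    obtain ⟨η, hη, c, hc, H⟩ := ih
    refine ⟨min (d * η) (1 / (2 * (r + 1))), by positivity, c * d ^ r / 2, by positivity,
      fun {V} _ G A hA => ?_⟩
    set η' := min (d * η) (1 / (2 * (r + 1)) : ℝ) with hη'
    have hη'0 : 0 ≤ η' := by positivity
    have hη'r : (r + 1) * η' ≤ 1 / 2 := by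
      calc (r + 1) * η' ≤ (r + 1) * (1 / (2 * (r + 1))) := by gcongr; exact min_le_right _ _
        _ = 1 / 2 := by field_simp
    have hη'1 : η' ≤ 1 := by nlinarith [(Nat.cast_nonneg r : (0 : ℝ) ≤ r)]
    let bad : Fin r → Finset V := fun j =>
      {v ∈ A 0 | (#{w ∈ A j.succ | G.Adj v w} : ℝ) < d * #(A j.succ)}
    let good := A 0 \ univ.biUnion bad
    have hbad : (#(univ.biUnion bad) : ℝ) ≤ r * (η' * #(A 0)) := by
      calc (#(univ.biUnion bad) : ℝ) ≤ ∑ j, (#(bad j) : ℝ) := by exact_mod_cast card_biUnion_le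
        _ ≤ ∑ _j : Fin r, η' * #(A 0) := sum_le_sum fun j _ =>
            (hA 0 j.succ (Fin.succ_pos j)).card_lowDegree_le hη'0 hη'1
        _ = r * (η' * #(A 0)) := by simp
    have hgood : (#(A 0) : ℝ) / 2 ≤ #good := by
      have h1 : (#(A 0) : ℝ) ≤ #good + #(univ.biUnion bad) := by
        exact_mod_cast card_le_card_sdiff_add_card
      have h2 : (r + 1) * η' * #(A 0) ≤ 1 / 2 * #(A 0) := by gcongr
      nlinarith [mul_nonneg hη'0 (Nat.cast_nonneg (#(A 0)) : (0 : ℝ) ≤ _)]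
    let B : V → Fin r → Finset V := fun v j => {w ∈ A j.succ | G.Adj v w}
    have hB : ∀ v ∈ good, ∀ j, d * #(A j.succ) ≤ #(B v j) := by
      intro v hv j
      by_contra! hlt
      have hv' := mem_sdiff.1 hv
      exact hv'.2 (mem_biUnion.2 ⟨j, mem_univ _, mem_filter.2 ⟨hv'.1, hlt⟩⟩)
    have hcount : ∀ v ∈ good, c * d ^ r * ∏ j : Fin r, (#(A j.succ) : ℝ) ≤
        #{f ∈ cliqueTuples G r | ∀ i, f i ∈ B v i} := by
      intro v hv
      refine le_trans ?_ (H G (B v) fun i j hij =>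
        (hA i.succ j.succ (Fin.succ_lt_succ_iff.2 hij)).subset hη.le (min_le_left _ _)
          (filter_subset _ _) (filter_subset _ _) (hB v hv i) (hB v hv j))
      have : d ^ r * ∏ j : Fin r, (#(A j.succ) : ℝ) = ∏ j : Fin r, d * (#(A j.succ) : ℝ) := by
        rw [prod_mul_distrib]; simp
      rw [mul_assoc, this]
      gcongr with j
      exact hB v hv j
    have hinj : ∑ v ∈ good, #{f ∈ cliqueTuples G r | ∀ i, f i ∈ B v i} ≤
        #{f ∈ cliqueTuples G (r + 1) | ∀ i, f i ∈ A i} := sum_card_cliqueTuples_le G A sdiff_subset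
    have hinj' : ∑ v ∈ good, (#{f ∈ cliqueTuples G r | ∀ i, f i ∈ B v i} : ℝ) ≤
        #{f ∈ cliqueTuples G (r + 1) | ∀ i, f i ∈ A i} := by exact_mod_cast hinj
    refine le_trans ?_ ((sum_le_sum hcount).trans hinj')
    rw [Fin.prod_univ_succ, sum_const, nsmul_eq_mul]
    calc c * d ^ r / 2 * (#(A 0) * ∏ j : Fin r, (#(A j.succ) : ℝ))
        = #(A 0) / 2 * (c * d ^ r * ∏ j : Fin r, (#(A j.succ) : ℝ)) := by ring
      _ ≤ #good * (c * d ^ r * ∏ j : Fin r, (#(A j.succ) : ℝ)) :=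
          mul_le_mul_of_nonneg_right hgood (mul_nonneg (by positivity)
            (prod_nonneg fun _ _ => Nat.cast_nonneg _))

/-! ### The clique removal lemma -/

open Classical in
/-- The ordered pairs of vertices that are adjacent in `G` but not in `G'`. -/
noncomputable def lostPairs {V : Type*} [Fintype V] (G G' : SimpleGraph V) : Finset (V × V) :=
  {p | G.Adj p.1 p.2 ∧ ¬ G'.Adj p.1 p.2}

theorem card_lostPairs_le_add {V : Type*} [Fintype V] (G G' G'' : SimpleGraph V) :
    #(lostPairs G G'') ≤ #(lostPairs G G') + #(lostPairs G' G'') := by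
  classical
  refine le_trans (card_le_card fun p hp => ?_) (card_union_le _ _)
  simp only [lostPairs, mem_filter, mem_univ, true_and, mem_union] at hp ⊢
  tauto

open Classical in
theorem lowerRegular_of_isUniform {V : Type*} {G : SimpleGraph V} {η η₀ d : ℝ} {A B : Finset V}
    (h : G.IsUniform η A B) (hη : η ≤ η₀) (hηd : η ≤ d) (hd : 2 * d ≤ G.edgeDensity A B) :
    LowerRegular G η₀ d A B := by
  intro X hX Y hY hXc hYc
  have h1 : (#A : ℝ) * η ≤ #X := by
    rw [mul_comm]; exact le_trans (by gcongr) hXc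
  have h2 : (#B : ℝ) * η ≤ #Y := by
    rw [mul_comm]; exact le_trans (by gcongr) hYc
  have h3 := (abs_lt.1 (h hX hY h1 h2)).1
  have h4 : d ≤ G.edgeDensity X Y := by linarith
  rcases X.eq_empty_or_nonempty with rfl | hXne
  · simp
  rcases Y.eq_empty_or_nonempty with rfl | hYne
  · simp
  have hpos : (0 : ℝ) < #X * #Y := by
    have := hXne.card_pos; have := hYne.card_pos; positivity
  rw [SimpleGraph.edgeDensity_def] at h4
  push_cast at h4
  exact (le_div_iff₀ hpos).1 h4

open Classical in
theorem card_lostPairs_regularityReduced_le {V : Type*} [Fintype V] [Nonempty V]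
    {G : SimpleGraph V} {P : Finpartition (univ : Finset V)} {η d ε : ℝ} (hη : 0 < η) (hd : 0 ≤ d)
    (hε : 0 < ε) (hP : P.IsEquipartition) (hPη : P.IsUniform G η) (hPε : 4 / ε ≤ #P.parts) :
    (#(lostPairs G (G.regularityReduced P η d)) : ℝ) ≤
      (4 * η + ε / 2 + 4 * d) * Fintype.card V ^ 2 := by
  let A := (P.nonUniforms G η).biUnion fun (U, W) ↦ U ×ˢ W
  let B := P.parts.biUnion offDiag
  let C := (P.sparsePairs G d).biUnion fun (U, W) ↦ G.interedges U W
  have hsub : lostPairs G (G.regularityReduced P η d) ⊆ A ∪ B ∪ C := by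
    rintro ⟨x, y⟩ hxy
    simp only [lostPairs, mem_filter, mem_univ, true_and, SimpleGraph.regularityReduced_adj,
      not_and, not_exists, not_le] at hxy
    obtain ⟨h, h'⟩ := hxy
    obtain ⟨U, hU, hx⟩ := P.exists_mem (mem_univ x)
    obtain ⟨W, hW, hy⟩ := P.exists_mem (mem_univ y)
    rw [mem_union, mem_union]
    by_cases hUW : U = W
    · subst hUW
      exact Or.inl (Or.inr (mem_biUnion.2 ⟨U, hU, mem_offDiag.2 ⟨hx, hy, h.ne⟩⟩))
    by_cases hG : G.IsUniform η U W
    · refine Or.inr (mem_biUnion.2 ⟨(U, W), ?_, (G.mk_mem_interedges_iff).2 ⟨hx, hy, h⟩⟩)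
      exact (P.mk_mem_sparsePairs G _ _ _).2
        ⟨hU, hW, hUW, h' h _ hU _ hW hx hy hUW hG⟩
    · exact Or.inl (Or.inl (mem_biUnion.2
        ⟨(U, W), (P.mk_mem_nonUniforms G).2 ⟨hU, hW, hUW, hG⟩, mem_product.2 ⟨hx, hy⟩⟩))
  have hA : (#A : ℝ) < 4 * η * #(univ : Finset V) ^ 2 :=
    hP.sum_nonUniforms_lt univ_nonempty hη hPη
  have hB : (#B : ℝ) ≤ ε / 2 * #(univ : Finset V) ^ 2 := hP.card_biUnion_offDiag_le hε hPε
  have hC : (#C : ℝ) ≤ 4 * d * #(univ : Finset V) ^ 2 := hP.card_interedges_sparsePairs_le hd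
  have hABC : (#(lostPairs G (G.regularityReduced P η d)) : ℝ) ≤ #A + #B + #C := by
    exact_mod_cast (card_le_card hsub).trans ((card_union_le _ _).trans
      (Nat.add_le_add_right (card_union_le _ _) _))
  rw [card_univ] at hA hB hC
  linarith

/-- In an equipartition into at most `M` parts, every part has at least `card V / (2 M)`
elements. -/
theorem card_div_le_card_part {V : Type*} [Fintype V] [DecidableEq V]
    {P : Finpartition (univ : Finset V)} (hP : P.IsEquipartition) {M : ℕ} (hM : #P.parts ≤ M)
    {U : Finset V} (hU : U ∈ P.parts) : (Fintype.card V : ℝ) / (2 * M) ≤ #U := by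
  have hpos : 0 < #P.parts := card_pos.2 ⟨U, hU⟩
  have h1 : Fintype.card V / #P.parts ≤ #U := hP.average_le_card_part hU
  have h2 : 1 ≤ #U := (P.nonempty_of_mem_parts hU).card_pos
  have h3 : Fintype.card V < #P.parts * (Fintype.card V / #P.parts + 1) :=
    Nat.lt_mul_div_succ _ hpos
  have h4 : Fintype.card V ≤ M * (2 * #U) :=
    h3.le.trans (Nat.mul_le_mul hM (by omega))
  have hM0 : (0 : ℝ) < M := by exact_mod_cast hpos.trans_le hM
  rw [div_le_iff₀ (by positivity)]
  have h5 : (Fintype.card V : ℝ) ≤ M * (2 * #U) := by exact_mod_cast h4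
  linarith

/-- The clique removal lemma: a graph with few labelled `r`-cliques can be made free of them by
deleting few edges. -/
theorem clique_removal (r : ℕ) {ε : ℝ} (hε : 0 < ε) :
    ∃ c : ℝ, 0 < c ∧ ∀ {V : Type*} [Fintype V] (G : SimpleGraph V),
      (#(cliqueTuples G r) : ℝ) < c * Fintype.card V ^ r →
      ∃ G' ≤ G, cliqueTuples G' r = ∅ ∧ (#(lostPairs G G') : ℝ) ≤ ε * Fintype.card V ^ 2 := by
  classical
  obtain ⟨η₀, hη₀, c, hc, hcount⟩ := exists_counting (d := ε / 32) (by positivity) r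
  set η := min η₀ (ε / 32) with hη
  have hηpos : 0 < η := by positivity
  set l := ⌈8 / ε⌉₊ with hl
  have hl0 : 0 < l := Nat.ceil_pos.2 (by positivity)
  set M := SzemerediRegularity.bound η l with hM
  have hM0 : 0 < M := SzemerediRegularity.bound_pos _ _
  refine ⟨min (c / (2 * M) ^ r) (1 / l ^ r), by positivity, fun {V} _ G hG => ?_⟩
  rcases lt_or_ge (Fintype.card V) l with hV | hV
  · -- For few vertices the hypothesis leaves no labelled clique at all.
    have h1 : (#(cliqueTuples G r) : ℝ) < 1 := by
      calc (#(cliqueTuples G r) : ℝ) < _ := hG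
        _ ≤ 1 / l ^ r * l ^ r := by gcongr; exact min_le_right _ _
        _ = 1 := by field_simp
    have h2 : #(cliqueTuples G r) = 0 := by
      have : #(cliqueTuples G r) < 1 := by exact_mod_cast h1
      omega
    refine ⟨G, le_rfl, card_eq_zero.1 h2, ?_⟩
    have : lostPairs G G = ∅ := by simp [lostPairs]
    rw [this]
    simp only [card_empty, Nat.cast_zero]
    positivity
  have hne : Nonempty V := Fintype.card_pos_iff.1 (hl0.trans_le hV)
  obtain ⟨P, hPeq, hPl, hPM, hPu⟩ := szemeredi_regularity G hηpos hV
  refine ⟨G.regularityReduced P η (ε / 16), SimpleGraph.regularityReduced_le, ?_, ?_⟩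
  · rw [eq_empty_iff_forall_notMem]
    intro f hf
    rw [mem_cliqueTuples] at hf
    refine hG.not_ge ?_
    have hU : ∀ i, P.part (f i) ∈ P.parts := fun i => P.part_mem.2 (mem_univ _)
    have hreg : ∀ i j, i < j → LowerRegular G η₀ (ε / 32) (P.part (f i)) (P.part (f j)) := by
      intro i j hij
      obtain ⟨-, U, hU, W, hW, hiU, hjW, -, hGu, hGd⟩ := hf hij.ne
      rw [P.part_eq_of_mem hU hiU, P.part_eq_of_mem hW hjW]
      exact lowerRegular_of_isUniform hGu (min_le_left _ _) (min_le_right _ _) (by linarith)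
    calc min (c / (2 * M) ^ r) (1 / (l : ℝ) ^ r) * Fintype.card V ^ r
        ≤ c / (2 * M) ^ r * Fintype.card V ^ r := by gcongr; exact min_le_left _ _
      _ = c * ∏ _i : Fin r, (Fintype.card V : ℝ) / (2 * M) := by
        rw [prod_const, card_univ, Fintype.card_fin, div_pow]; ring
      _ ≤ c * ∏ i, (#(P.part (f i)) : ℝ) := by
        gcongr with i
        exact card_div_le_card_part hPeq hPM (hU i)
      _ ≤ _ := hcount G _ hreg
      _ ≤ #(cliqueTuples G r) := by gcongr; exact filter_subset _ _
  · refine (card_lostPairs_regularityReduced_le (ε := ε / 2) hηpos (by positivity) (by positivity)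
      hPeq hPu ?_).trans ?_
    · calc 4 / (ε / 2) = 8 / ε := by field_simp; norm_num
        _ ≤ l := Nat.le_ceil _
        _ ≤ #P.parts := by exact_mod_cast hPl
    · have : η ≤ ε / 32 := min_le_right _ _
      gcongr
      linarith

/-! ### Betti numbers and face numbers -/

theorem finrank_chain {V : Type*} [Finite V] (Δ : AbstractSimplicialComplex V) (k : ℕ) :
    Module.finrank (ZMod 2) (Chain Δ k) = numFaces Δ k := by
  rw [Module.finrank_fintype_fun_eq_card, ← Nat.card_eq_fintype_card, Nat.card_coe_set_eq]
  rfl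

theorem numFaces_le {V : Type*} [Fintype V] (Δ : AbstractSimplicialComplex V) (k : ℕ) :
    numFaces Δ k ≤ Fintype.card V ^ (k + 1) := by
  classical
  have hsub : kFaces Δ k ⊆ (powersetCard (k + 1) (univ : Finset V) : Set (Finset V)) :=
    fun S hS => mem_coe.2 (mem_powersetCard.2 ⟨subset_univ _, hS.2⟩)
  calc numFaces Δ k ≤ (powersetCard (k + 1) (univ : Finset V) : Set (Finset V)).ncard :=
        Set.ncard_le_ncard hsub (finite_toSet _)
    _ = (Fintype.card V).choose (k + 1) := by
        rw [Set.ncard_coe_finset, card_powersetCard, card_univ]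
    _ ≤ Fintype.card V ^ (k + 1) := Nat.choose_le_pow _ _

/-- The homology embeds into the quotient of all chains by the boundaries. -/
theorem betti_add_finrank_boundaries_le {V : Type*} [Finite V] [DecidableEq V]
    (Δ : AbstractSimplicialComplex V) (k : ℕ) :
    betti Δ k + Module.finrank (ZMod 2) (boundaries Δ k) ≤ numFaces Δ k := by
  have hinj : Function.Injective (((boundaries Δ k).comap (cycles Δ k).subtype).mapQ
      (boundaries Δ k) (cycles Δ k).subtype le_rfl) := by
    rw [← LinearMap.ker_eq_bot, Submodule.ker_mapQ]
    exact Submodule.mkQ_map_self _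
  have h1 := LinearMap.finrank_le_finrank_of_injective hinj
  have h2 := Submodule.finrank_quotient_add_finrank (boundaries Δ k)
  rw [finrank_chain] at h2
  have h3 : betti Δ k ≤ Module.finrank (ZMod 2) (Chain Δ k ⧸ boundaries Δ k) := h1
  omega

theorem betti_eq_finrank_cycles {V : Type*} [Finite V] [DecidableEq V]
    (Δ : AbstractSimplicialComplex V) (k : ℕ) (h : numFaces Δ (k + 1) = 0) :
    betti Δ k = Module.finrank (ZMod 2) (cycles Δ k) := by
  have hempty : IsEmpty (kFaces Δ (k + 1)) :=
    Set.isEmpty_coe_sort.2 ((Set.ncard_eq_zero (Set.toFinite _)).1 h)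
  have hbot : boundaries Δ k = ⊥ := by
    rw [boundaries, LinearMap.range_eq_bot]
    exact Subsingleton.elim _ _
  have hbot' : (boundaries Δ k).submoduleOf (cycles Δ k) = ⊥ := by
    rw [hbot, Submodule.submoduleOf, Submodule.comap_bot, Submodule.ker_subtype]
  exact (Submodule.quotEquivOfEqBot _ hbot').finrank_eq

/-- Without `(k + 1)`-faces, the only obstruction to full homology is the boundary operator into the
small space of `(k - 1)`-chains. -/
theorem numFaces_le_betti_add {V : Type*} [Fintype V] [DecidableEq V]
    (Δ : AbstractSimplicialComplex V) (k : ℕ) (h : numFaces Δ (k + 1) = 0) :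
    numFaces Δ k ≤ betti Δ k + Fintype.card V ^ k := by
  rw [betti_eq_finrank_cycles Δ k h, ← finrank_chain]
  cases k with
  | zero =>
    rw [cycles, finrank_top]
    exact Nat.le_add_right _ _
  | succ k =>
    have h1 := LinearMap.finrank_range_add_finrank_ker (boundary Δ k)
    have h2 : Module.finrank (ZMod 2) (LinearMap.range (boundary Δ k)) ≤ Fintype.card V ^ (k + 1) :=
      (Submodule.finrank_le _).trans ((finrank_chain Δ k).trans_le (numFaces_le Δ k))
    rw [cycles]
    omega

theorem betti_zero_eq {V : Type*} [Finite V] [DecidableEq V]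
    (Δ : AbstractSimplicialComplex V) (h : numFaces Δ 1 = 0) : betti Δ 0 = numFaces Δ 0 := by
  rw [betti_eq_finrank_cycles Δ 0 h, cycles, finrank_top, finrank_chain]

theorem boundary_single_apply {V : Type*} [Finite V] [DecidableEq V]
    (Δ : AbstractSimplicialComplex V) (k : ℕ) (S : kFaces Δ (k + 1)) (T : kFaces Δ k) :
    boundary Δ k (Pi.single S 1) T = ∑ v ∈ S.1, if T.1 = S.1.erase v then 1 else 0 := by
  classical
  rw [boundary, Fintype.linearCombination_apply_single, one_smul, Finset.sum_apply,
    ← Finset.sum_coe_sort S.1]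
  refine sum_congr rfl fun v _ => ?_
  rw [Pi.single_apply]
  simp only [Subtype.ext_iff]

/-- The boundaries of the `(k + 1)`-faces through a vertex `v` are linearly independent: the face
`S \ {v}` occurs in the boundary of `S` only. -/
theorem card_star_le_finrank_boundaries {V : Type*} [Finite V] [DecidableEq V]
    (Δ : AbstractSimplicialComplex V) (k : ℕ) (v : V) :
    {S | S ∈ kFaces Δ (k + 1) ∧ v ∈ S}.ncard ≤ Module.finrank (ZMod 2) (boundaries Δ k) := by
  classical
  set T := {S | S ∈ kFaces Δ (k + 1) ∧ v ∈ S} with hT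
  have : Fintype T := Fintype.ofFinite _
  let b : T → boundaries Δ k := fun S =>
    ⟨boundary Δ k (Pi.single ⟨S.1, S.2.1⟩ 1), LinearMap.mem_range_self _ _⟩
  let φ : Chain Δ k →ₗ[ZMod 2] (T → ZMod 2) :=
    LinearMap.funLeft (ZMod 2) (ZMod 2) fun S => ⟨S.1.erase v, erase_mem_kFaces Δ k S.2.1 S.2.2⟩
  have hφ : ((φ ∘ₗ (boundaries Δ k).subtype) ∘ b) = Pi.basisFun (ZMod 2) T := by
    ext S S'
    simp only [Function.comp_apply, LinearMap.comp_apply, Submodule.subtype_apply,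
      Pi.basisFun_apply, b, φ, LinearMap.funLeft_apply, boundary_single_apply]
    have hvS := S.2.2
    rw [sum_eq_single v, Pi.single_apply]
    · congr 1
      rw [eq_iff_iff]
      constructor
      · intro h
        rw [Subtype.ext_iff, ← insert_erase S'.2.2, ← insert_erase S.2.2, h]
      · rintro rfl
        rfl
    · intro w _ hw
      rw [if_neg]
      intro h
      have : v ∈ S.1.erase w := mem_erase.2 ⟨hw.symm, hvS⟩
      rw [← h] at this
      exact notMem_erase v _ this
    · exact fun h => absurd hvS h
  have hli : LinearIndependent (ZMod 2) b := by
    refine LinearIndependent.of_comp (φ ∘ₗ (boundaries Δ k).subtype) ?_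
    rw [hφ]
    exact (Pi.basisFun (ZMod 2) T).linearIndependent
  have := hli.fintype_card_le_finrank
  rwa [← Nat.card_eq_fintype_card, Nat.card_coe_set_eq] at this

theorem numFaces_succ_le {V : Type*} [Fintype V] [DecidableEq V]
    (Δ : AbstractSimplicialComplex V) (k : ℕ) :
    numFaces Δ (k + 1) ≤ Fintype.card V * Module.finrank (ZMod 2) (boundaries Δ k) := by
  classical
  have hcover : (kFaces Δ (k + 1)).toFinset ⊆
      univ.biUnion fun v => {S ∈ (kFaces Δ (k + 1)).toFinset | v ∈ S} := by
    intro S hS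
    rw [Set.mem_toFinset] at hS
    obtain ⟨v, hv⟩ : S.Nonempty := card_pos.1 (by rw [hS.2]; omega)
    exact mem_biUnion.2 ⟨v, mem_univ _, mem_filter.2 ⟨Set.mem_toFinset.2 hS, hv⟩⟩
  rw [numFaces, Set.ncard_eq_toFinset_card', ← card_univ]
  refine (card_le_card hcover).trans (card_biUnion_le_card_mul _ _ _ fun v _ => ?_)
  refine le_of_eq_of_le ?_ (card_star_le_finrank_boundaries Δ k v)
  rw [← Set.ncard_coe_finset]
  congr 1
  ext S
  simp

/-- A large Betti number forces few faces of the next dimension. -/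
theorem numFaces_succ_add_le {V : Type*} [Fintype V] [DecidableEq V]
    (Δ : AbstractSimplicialComplex V) (k : ℕ) :
    numFaces Δ (k + 1) + Fintype.card V * betti Δ k ≤ Fintype.card V * numFaces Δ k := by
  calc numFaces Δ (k + 1) + Fintype.card V * betti Δ k
      ≤ Fintype.card V * Module.finrank (ZMod 2) (boundaries Δ k) +
        Fintype.card V * betti Δ k := Nat.add_le_add_right (numFaces_succ_le Δ k) _
    _ = Fintype.card V * (betti Δ k + Module.finrank (ZMod 2) (boundaries Δ k)) := by ring
    _ ≤ Fintype.card V * numFaces Δ k :=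
      Nat.mul_le_mul_left _ (betti_add_finrank_boundaries_le Δ k)

/-- A full `(k + 1)`-st homology requires every `(k + 1)`-chain to be a cycle, hence the absence of
`(k + 1)`-faces. -/
theorem numFaces_succ_eq_zero_of_le_betti {V : Type*} [Fintype V] [DecidableEq V]
    (Δ : AbstractSimplicialComplex V) (k : ℕ) (h : numFaces Δ (k + 1) ≤ betti Δ (k + 1)) :
    numFaces Δ (k + 1) = 0 := by
  have h1 : betti Δ (k + 1) ≤ Module.finrank (ZMod 2) (cycles Δ (k + 1)) :=
    Submodule.finrank_quotient_le _
  have h2 := LinearMap.finrank_range_add_finrank_ker (boundary Δ k)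
  rw [finrank_chain] at h2
  have h3 : Module.finrank (ZMod 2) (boundaries Δ k) = 0 := by
    rw [cycles] at h1
    rw [boundaries]
    omega
  have h4 := numFaces_succ_le Δ k
  rw [h3, mul_zero] at h4
  omega

/-! ### Faces of the clique complex and labelled cliques -/

theorem card_cliqueTuples_le {V : Type*} [Fintype V] (G : SimpleGraph V) (k : ℕ) :
    #(cliqueTuples G (k + 1)) ≤ (k + 1) ^ (k + 1) * numFaces (cliqueComplex G) k := by
  classical
  rw [numFaces, Set.ncard_eq_toFinset_card']
  refine card_le_mul_card_image_of_maps_to (f := fun f => univ.image f) ?_ _ ?_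
  · intro f hf
    rw [mem_cliqueTuples] at hf
    rw [Set.mem_toFinset]
    refine ⟨⟨univ_nonempty.image f, ?_⟩, ?_⟩
    · intro x hx y hy hxy
      rw [mem_coe, mem_image] at hx hy
      obtain ⟨i, -, rfl⟩ := hx
      obtain ⟨j, -, rfl⟩ := hy
      exact hf fun h => hxy (h ▸ rfl)
    · rw [card_image_of_injective, card_univ, Fintype.card_fin]
      intro i j hij
      by_contra hne
      exact (hf hne).ne hij
  · intro S hS
    rw [Set.mem_toFinset] at hS
    calc #{f ∈ cliqueTuples G (k + 1) | univ.image f = S}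
        ≤ #(Fintype.piFinset fun _ : Fin (k + 1) => S) := by
          refine card_le_card fun f hf => ?_
          rw [mem_filter] at hf
          exact Fintype.mem_piFinset.2 fun i => hf.2 ▸ mem_image_of_mem f (mem_univ i)
      _ = (k + 1) ^ (k + 1) := by
          rw [Fintype.card_piFinset_const, hS.2]

theorem numFaces_eq_zero_iff {V : Type*} [Fintype V] {G : SimpleGraph V} {k : ℕ} :
    numFaces (cliqueComplex G) k = 0 ↔ cliqueTuples G (k + 1) = ∅ := by
  constructor
  · intro h
    have := card_cliqueTuples_le G k
    rw [h, mul_zero] at this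
    exact card_eq_zero.1 (Nat.le_zero.1 this)
  · intro h
    rw [numFaces, Set.ncard_eq_zero (Set.toFinite _), Set.eq_empty_iff_forall_notMem]
    intro S hS
    let e := S.equivFinOfCardEq hS.2
    have : (fun i => (e.symm i : V)) ∈ cliqueTuples G (k + 1) := by
      rw [mem_cliqueTuples]
      intro i j hij
      exact hS.1.2 (e.symm i).2 (e.symm j).2
        fun h => hij (e.symm.injective (Subtype.ext h))
    rw [h] at this
    exact notMem_empty _ this

/-! ### Nonadaptive query algorithms -/

theorem primrec_nat_pow : Primrec₂ ((· ^ ·) : ℕ → ℕ → ℕ) :=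
  Primrec₂.unpaired'.1 Nat.Primrec.pow

/-- The algorithm that makes the `Q` queries `query n r 0, …, query n r (Q - 1)`, whatever the
answers are, and then says YES if and only if the pair of `min n N` and the list of answers is in the
table `T`. Thus the decision depends on `n` for `n < N` only. -/
def nonadaptive (seeds : ℕ → ℕ) (seeds_pos : ∀ n, 0 < seeds n) (seeds_primrec : Primrec seeds)
    (query : ℕ → ℕ → ℕ → ℕ × ℕ)
    (query_primrec : Primrec fun x : ℕ × ℕ × ℕ => query x.1 x.2.1 x.2.2)
    (Q N : ℕ) (T : List (ℕ × List Bool)) : QueryAlgorithm where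
  numSeeds := seeds
  numSeeds_pos := seeds_pos
  numSeeds_computable := seeds_primrec.to_comp
  next n r h := if h.length < Q then Sum.inl (query n r h.length)
    else Sum.inr (decide (∃ a ∈ T, a = (min n N, h)))
  next_computable := by
    refine Primrec.to_comp (Primrec.ite ?_ ?_ ?_)
    · exact Primrec.nat_lt.comp (Primrec.list_length.comp (Primrec.snd.comp Primrec.snd))
        (Primrec.const Q)
    · exact Primrec.sumInl.comp (query_primrec.comp (Primrec.pair Primrec.fst
        (Primrec.pair (Primrec.fst.comp Primrec.snd)
          (Primrec.list_length.comp (Primrec.snd.comp Primrec.snd)))))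
    · have hmem : PrimrecRel fun (L : List (ℕ × List Bool)) b => ∃ a ∈ L, a = b :=
        PrimrecRel.exists_mem_list Primrec.eq
      exact Primrec.sumInr.comp ((hmem.comp (Primrec.const T) (Primrec.pair
        (Primrec.nat_min.comp Primrec.fst (Primrec.const N))
        (Primrec.snd.comp Primrec.snd))).decide)

/-- The answers to the queries `query 0, …, query (Q - 1)`. -/
noncomputable def answers {n : ℕ} (G : SimpleGraph (Fin n)) (query : ℕ → ℕ × ℕ) (Q : ℕ) :
    List Bool :=
  (List.range Q).map fun t => adjEntry G (query t).1 (query t).2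

theorem run_nonadaptive {seeds seeds_pos seeds_primrec query query_primrec Q N T}
    {n : ℕ} (G : SimpleGraph (Fin n)) (r : ℕ) :
    (nonadaptive seeds seeds_pos seeds_primrec query query_primrec Q N T).run Q G r =
      some (decide ((min n N, answers G (query n r) Q) ∈ T)) := by
  set A := nonadaptive seeds seeds_pos seeds_primrec query query_primrec Q N T with hA
  have key : ∀ (q : ℕ) (h : List Bool), h.length + q = Q →
      A.runFrom G r q h = some (decide ((min n N, h ++ (List.range' h.length q).map
        fun t => adjEntry G (query n r t).1 (query n r t).2) ∈ T)) := by
    intro q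
    induction q with
    | zero =>
      intro h hh
      simp [QueryAlgorithm.runFrom, hA, nonadaptive, show ¬ h.length < Q by omega]
    | succ q ih =>
      intro h hh
      have hnext : A.next n r h = Sum.inl (query n r h.length) := if_pos (by omega)
      rw [QueryAlgorithm.runFrom, hnext]
      refine (ih _ (by simp; omega)).trans ?_
      rw [List.range'_succ]
      simp
  rw [QueryAlgorithm.run, key Q [] (by simp), answers, List.range_eq_range']
  simp

/-! ### Sampling labelled cliques -/

/-- The vertex number `a` of the sample number `i` that the seed `r` encodes: the base `n ^ s` digits
of `r` are the samples, and the base `n` digits of a sample are its vertices. -/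
def sampleVertex (s n r i a : ℕ) : ℕ := r / (n ^ s) ^ i % n ^ s / n ^ a % n

/-- The queries of the tester, which samples `s`-tuples of vertices. For `n < N` it reads the whole
matrix; otherwise query number `(i * s + a) * s + b` asks whether the vertices `a` and `b` of sample
`i` are adjacent. -/
def sampleQuery (s N n r t : ℕ) : ℕ × ℕ :=
  if n < N then (t / N, t % N)
  else (sampleVertex s n r (t / s / s) (t / s % s), sampleVertex s n r (t / s / s) (t % s))

theorem sampleVertex_primrec (s : ℕ) {α : Type*} [Primcodable α] {n r i a : α → ℕ}
    (hn : Primrec n) (hr : Primrec r) (hi : Primrec i) (ha : Primrec a) :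
    Primrec fun x => sampleVertex s (n x) (r x) (i x) (a x) := by
  have hns : Primrec fun x => n x ^ s := primrec_nat_pow.comp hn (Primrec.const s)
  exact Primrec.nat_mod.comp (Primrec.nat_div.comp (Primrec.nat_mod.comp (Primrec.nat_div.comp hr
    (primrec_nat_pow.comp hns hi)) hns) (primrec_nat_pow.comp hn ha)) hn

theorem sampleQuery_primrec (s N : ℕ) :
    Primrec fun x : ℕ × ℕ × ℕ => sampleQuery s N x.1 x.2.1 x.2.2 := by
  have hn : Primrec fun x : ℕ × ℕ × ℕ => x.1 := Primrec.fst
  have hr : Primrec fun x : ℕ × ℕ × ℕ => x.2.1 := Primrec.fst.comp Primrec.snd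
  have ht : Primrec fun x : ℕ × ℕ × ℕ => x.2.2 := Primrec.snd.comp Primrec.snd
  have hts : Primrec fun x : ℕ × ℕ × ℕ => x.2.2 / s := Primrec.nat_div.comp ht (Primrec.const s)
  have htss := Primrec.nat_div.comp hts (Primrec.const s)
  refine Primrec.ite (Primrec.nat_lt.comp hn (Primrec.const N)) ?_ ?_
  · exact Primrec.pair (Primrec.nat_div.comp ht (Primrec.const N))
      (Primrec.nat_mod.comp ht (Primrec.const N))
  · exact Primrec.pair
      (sampleVertex_primrec s hn hr htss (Primrec.nat_mod.comp hts (Primrec.const s)))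
      (sampleVertex_primrec s hn hr htss (Primrec.nat_mod.comp ht (Primrec.const s)))

/-- The number of seeds: one for each sequence of `m` tuples of `s` vertices. The maximum only makes
it positive for the empty graph. -/
def sampleSeeds (s m n : ℕ) : ℕ := ((max n 1) ^ s) ^ m

theorem sampleSeeds_pos (s m n : ℕ) : 0 < sampleSeeds s m n := by
  unfold sampleSeeds
  positivity

theorem sampleSeeds_primrec (s m : ℕ) : Primrec (sampleSeeds s m) :=
  primrec_nat_pow.comp (primrec_nat_pow.comp
    (Primrec.nat_max.comp Primrec.id (Primrec.const 1)) (Primrec.const s)) (Primrec.const m)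

/-- The seeds correspond to the sequences of `m` tuples of `s` vertices. -/
def seedEquiv (s m n : ℕ) : (Fin m → Fin s → Fin n) ≃ Fin ((n ^ s) ^ m) :=
  (Equiv.piCongrRight fun _ => finFunctionFinEquiv).trans finFunctionFinEquiv

theorem sampleVertex_seedEquiv {s m n : ℕ} (F : Fin m → Fin s → Fin n) (i : Fin m) (a : Fin s) :
    sampleVertex s n (seedEquiv s m n F) i a = F i a := by
  have h := (seedEquiv s m n).symm_apply_apply F
  conv_rhs => rw [← h]
  rfl

/-- The answers of sample number `i` say that its vertices are pairwise adjacent. -/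
def SampleIsClique (s : ℕ) (h : List Bool) (i : ℕ) : Prop :=
  ∀ a < s, ∀ b < s, a ≠ b → h[(i * s + a) * s + b]? = some true

theorem adjEntry_eq_true {n : ℕ} {G : SimpleGraph (Fin n)} {u v : Fin n} :
    adjEntry G u v = true ↔ G.Adj u v := by
  simp [adjEntry]

theorem sampleIsClique_answers {s m n N Q : ℕ} (hN : N ≤ n) (hQ : m * (s * s) ≤ Q)
    (G : SimpleGraph (Fin n)) (F : Fin m → Fin s → Fin n) (i : Fin m) :
    SampleIsClique s (answers G (sampleQuery s N n (seedEquiv s m n F)) Q) i ↔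
      F i ∈ cliqueTuples G s := by
  have key : ∀ a b : Fin s,
      (answers G (sampleQuery s N n (seedEquiv s m n F)) Q)[((i : ℕ) * s + a) * s + b]? =
        some true ↔ G.Adj (F i a) (F i b) := by
    intro a b
    have hs : 0 < s := a.pos
    have h1 : (((i : ℕ) * s + a) * s + b) / s = i * s + a := by
      rw [mul_comm, Nat.mul_add_div hs, Nat.div_eq_of_lt b.2, add_zero]
    have h2 : (((i : ℕ) * s + a) * s + b) % s = b := by
      rw [mul_comm, Nat.mul_add_mod, Nat.mod_eq_of_lt b.2]
    have h3 : ((i : ℕ) * s + a) / s = i := by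
      rw [mul_comm, Nat.mul_add_div hs, Nat.div_eq_of_lt a.2, add_zero]
    have h4 : ((i : ℕ) * s + a) % s = a := by
      rw [mul_comm, Nat.mul_add_mod, Nat.mod_eq_of_lt a.2]
    have h5 : ((i : ℕ) * s + a) * s + b < Q := by
      have hi := i.2
      have ha := a.2
      have hb := b.2
      calc ((i : ℕ) * s + a) * s + b < (i * s + a + 1) * s := by nlinarith
        _ ≤ ((i + 1) * s) * s := Nat.mul_le_mul_right _ (by nlinarith)
        _ = (i + 1) * (s * s) := by ring
        _ ≤ m * (s * s) := Nat.mul_le_mul_right _ hi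
        _ ≤ Q := hQ
    rw [answers, List.getElem?_map, List.getElem?_range h5, Option.map_some, Option.some_inj,
      sampleQuery, if_neg (not_lt.2 hN)]
    simp only [h1, h2, h3, h4, sampleVertex_seedEquiv, adjEntry_eq_true]
  rw [mem_cliqueTuples]
  constructor
  · intro h a b hab
    exact (key a b).1 (h a a.2 b b.2 (Fin.val_ne_of_ne hab))
  · intro h a ha b hb hab
    exact (key ⟨a, ha⟩ ⟨b, hb⟩).2 (h (Fin.ne_of_val_ne hab))

/-- The answers for `n < N` determine the graph. -/
theorem answers_sampleQuery_injective {s n N Q r r' : ℕ} (hN : n < N) (hQ : N * N ≤ Q)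
    {G G' : SimpleGraph (Fin n)}
    (h : answers G (sampleQuery s N n r) Q = answers G' (sampleQuery s N n r') Q) : G = G' := by
  ext u v
  have hlt : (u : ℕ) * N + v < Q := by
    have := u.2
    have := v.2
    nlinarith
  have h1 := congrArg (fun l => l[(u : ℕ) * N + v]?) h
  have h2 : ((u : ℕ) * N + v) / N = u := by
    rw [mul_comm, Nat.mul_add_div (by omega), Nat.div_eq_of_lt (v.2.trans hN), add_zero]
  have h3 : ((u : ℕ) * N + v) % N = v := by
    rw [mul_comm, Nat.mul_add_mod, Nat.mod_eq_of_lt (v.2.trans hN)]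
  simp only [answers, List.getElem?_map, List.getElem?_range hlt, Option.map_some,
    Option.some_inj, sampleQuery, if_pos hN, h2, h3] at h1
  rw [← adjEntry_eq_true, h1, adjEntry_eq_true]

/-- The inputs of the final decision on which the tester says YES: for `n < N` the graph, known
completely, has the property; for `n = N`, which stands for all `n ≥ N`, no sample is a clique. -/
def acceptSet (P : GraphProperty) (s m N Q : ℕ) : Set (ℕ × List Bool) :=
  {x | x.1 ≤ N ∧ x.2.length = Q ∧
    ((x.1 < N ∧ ∃ G : SimpleGraph (Fin x.1), P x.1 G ∧ answers G (sampleQuery s N x.1 0) Q = x.2) ∨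
      (x.1 = N ∧ ∀ i < m, ¬ SampleIsClique s x.2 i))}

theorem acceptSet_finite (P : GraphProperty) (s m N Q : ℕ) : (acceptSet P s m N Q).Finite :=
  ((Set.finite_Iic N).prod (List.finite_length_eq Bool Q)).subset fun _ hx => ⟨hx.1, hx.2.1⟩

/-- The tester that samples `m` tuples of `s` vertices and says NO if one of them is a clique; on
graphs with fewer than `N` vertices it decides the property `P`. -/
noncomputable def cliqueTester (P : GraphProperty) (s m N Q : ℕ) : QueryAlgorithm :=
  nonadaptive (sampleSeeds s m) (sampleSeeds_pos s m) (sampleSeeds_primrec s m)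
    (sampleQuery s N) (sampleQuery_primrec s N) Q N (acceptSet_finite P s m N Q).toFinset.toList

open Classical in
theorem run_cliqueTester {P : GraphProperty} {s m N Q n : ℕ} (G : SimpleGraph (Fin n)) (r : ℕ) :
    (cliqueTester P s m N Q).run Q G r =
      some (decide ((min n N, answers G (sampleQuery s N n r) Q) ∈ acceptSet P s m N Q)) := by
  rw [cliqueTester, run_nonadaptive]
  simp

theorem run_cliqueTester_of_lt {P : GraphProperty} {s m N Q n : ℕ} (hn : n < N)
    (hQ : N * N ≤ Q) (G : SimpleGraph (Fin n)) (r : ℕ) (b : Bool) :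
    (cliqueTester P s m N Q).run Q G r = some b ↔ (b = true ↔ P n G) := by
  classical
  have hiff : (min n N, answers G (sampleQuery s N n r) Q) ∈ acceptSet P s m N Q ↔ P n G := by
    rw [min_eq_left hn.le]
    constructor
    · rintro ⟨-, -, ⟨-, G', hP, hG'⟩ | ⟨h, -⟩⟩
      · exact answers_sampleQuery_injective hn hQ hG' ▸ hP
      · exact absurd h hn.ne
    · intro hP
      have hquery : sampleQuery s N n 0 = sampleQuery s N n r := by
        funext t
        simp [sampleQuery, hn]
      exact ⟨hn.le, by simp [answers], Or.inl ⟨hn, G, hP, by rw [hquery]⟩⟩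
  rw [run_cliqueTester, Option.some_inj, ← hiff]
  cases b <;> simp

theorem run_cliqueTester_eq_true_iff {P : GraphProperty} {s m N Q n : ℕ} (hn : N ≤ n)
    (hQ : m * (s * s) ≤ Q) (G : SimpleGraph (Fin n)) (F : Fin m → Fin s → Fin n) :
    (cliqueTester P s m N Q).run Q G (seedEquiv s m n F) = some true ↔
      ∀ i, F i ∉ cliqueTuples G s := by
  classical
  rw [run_cliqueTester, Option.some_inj, decide_eq_true_iff, min_eq_right hn]
  constructor
  · rintro ⟨-, -, ⟨h, -⟩ | ⟨-, h⟩⟩ i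
    · exact absurd h (lt_irrefl _)
    · rw [← sampleIsClique_answers hn hQ G F i]
      exact h i i.2
  · intro h
    refine ⟨le_rfl, by simp [answers], Or.inr ⟨rfl, fun i hi => ?_⟩⟩
    have := h ⟨i, hi⟩
    rwa [← sampleIsClique_answers hn hQ G F ⟨i, hi⟩] at this

open Classical in
theorem card_filter_run_cliqueTester {P : GraphProperty} {s m N Q n : ℕ} (hn : N ≤ n)
    (hQ : m * (s * s) ≤ Q) (G : SimpleGraph (Fin n)) :
    #{r ∈ range ((n ^ s) ^ m) | (cliqueTester P s m N Q).run Q G r = some true} =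
      #(cliqueTuples G s)ᶜ ^ m := by
  rw [← Fintype.card_piFinset_const]
  symm
  refine card_nbij (fun F => (seedEquiv s m n F : ℕ)) ?_ ?_ ?_
  · intro F hF
    rw [mem_coe, mem_filter, mem_range, run_cliqueTester_eq_true_iff hn hQ]
    refine ⟨Fin.is_lt _, fun i => ?_⟩
    exact mem_compl.1 (Fintype.mem_piFinset.1 hF i)
  · intro F _ F' _ h
    exact (seedEquiv s m n).injective (Fin.ext h)
  · intro r hr
    rw [mem_coe, mem_filter, mem_range] at hr
    refine ⟨(seedEquiv s m n).symm ⟨r, hr.1⟩, ?_, by simp⟩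
    rw [mem_coe, Fintype.mem_piFinset]
    intro i
    rw [mem_compl]
    refine (run_cliqueTester_eq_true_iff (P := P) (N := N) hn hQ G _).1 ?_ i
    simpa using hr.2

theorem probOutput_false_add_true {P : GraphProperty} {s m N Q n : ℕ} (G : SimpleGraph (Fin n)) :
    (cliqueTester P s m N Q).probOutput Q G false + (cliqueTester P s m N Q).probOutput Q G true =
      1 := by
  classical
  have hpos := (cliqueTester P s m N Q).numSeeds_pos n
  rw [QueryAlgorithm.probOutput, QueryAlgorithm.probOutput, ← add_div, div_eq_one_iff_eq
    (by exact_mod_cast hpos.ne'), ← Nat.cast_add]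
  congr 1
  conv_rhs => rw [← card_range ((cliqueTester P s m N Q).numSeeds n)]
  rw [add_comm, ← card_filter_add_card_filter_not (s := range _)
    fun r => (cliqueTester P s m N Q).run Q G r = some true]
  congr 2
  refine filter_congr fun r _ => ?_
  simp [run_cliqueTester]

theorem probOutput_true_cliqueTester {P : GraphProperty} {s m N Q n : ℕ} (hn : N ≤ n)
    (hn0 : 0 < n) (hQ : m * (s * s) ≤ Q) (G : SimpleGraph (Fin n)) :
    (cliqueTester P s m N Q).probOutput Q G true = (1 - #(cliqueTuples G s) / (n : ℝ) ^ s) ^ m := by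
  classical
  have hseeds : (cliqueTester P s m N Q).numSeeds n = (n ^ s) ^ m := by
    change ((max n 1) ^ s) ^ m = _
    rw [max_eq_left (by omega)]
  have hle : #(cliqueTuples G s) ≤ n ^ s := by
    simpa using card_le_univ (cliqueTuples G s)
  rw [QueryAlgorithm.probOutput, hseeds]
  refine (congrArg (fun x : ℕ => (x : ℝ) / (((n ^ s) ^ m : ℕ) : ℝ))
    (card_filter_run_cliqueTester hn hQ G)).trans ?_
  have hn0' : (n : ℝ) ≠ 0 := by exact_mod_cast hn0.ne'
  rw [card_compl, Fintype.card_fun, Fintype.card_fin, Fintype.card_fin]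
  push_cast [Nat.cast_sub hle]
  rw [← div_pow, sub_div, div_self (pow_ne_zero _ hn0')]

/-! ### Edit distance -/

theorem graphDist_le_card_lostPairs_div {n : ℕ} {G G' : SimpleGraph (Fin n)} (h : G' ≤ G) :
    graphDist G G' ≤ #(lostPairs G G') / (n : ℝ) ^ 2 := by
  rw [graphDist]
  gcongr
  refine (ciInf_le (OrderBot.bddBelow _) (1 : Equiv.Perm (Fin n))).trans ?_
  have hmap : G'.map (1 : Equiv.Perm (Fin n)).toEmbedding = G' := by
    ext u v
    simp
  rw [hmap]
  have hsub : symmDiff G.edgeSet G'.edgeSet ⊆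
      ((lostPairs G G').image fun p => s(p.1, p.2) : Finset (Sym2 (Fin n))) := by
    intro e he
    induction e with
    | _ u v =>
      rw [Set.mem_symmDiff, SimpleGraph.mem_edgeSet, SimpleGraph.mem_edgeSet] at he
      have huv : G.Adj u v ∧ ¬ G'.Adj u v := he.resolve_right fun h' => h'.2 (h h'.1)
      exact mem_coe.2 (mem_image.2 ⟨(u, v), by simpa [lostPairs] using huv, rfl⟩)
  calc _ ≤ _ := Set.ncard_le_ncard hsub (finite_toSet _)
    _ ≤ _ := by
      rw [Set.ncard_coe_finset]
      exact card_image_le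

theorem not_isFar {P : GraphProperty} {ε : ℝ} (hε : 0 ≤ ε) {n : ℕ} {G G' : SimpleGraph (Fin n)}
    (hP : P n G') (h : G' ≤ G) (hlost : (#(lostPairs G G') : ℝ) ≤ ε * (n : ℝ) ^ 2) :
    ¬ IsFar P ε G := fun hfar =>
  (hfar G' hP).not_ge ((graphDist_le_card_lostPairs_div h).trans (div_le_of_le_mul₀ (by positivity) hε hlost))

/-! ### The testing criterion -/

/-- A property is testable if, on large graphs, it forces the density of labelled `s`-cliques to be
tiny, whereas being far from it forces that density to be at least `c`; it suffices that `m` samples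
tell the two densities apart. -/
theorem isTestable_of_cliqueTuples {P : GraphProperty} {ε c : ℝ} (hε : 0 ≤ ε) {s m N : ℕ}
    (hN : 0 < N) (hc : (1 - c) ^ m ≤ 1 / 3)
    (hyes : ∀ n, N ≤ n → ∀ G : SimpleGraph (Fin n), P n G →
      3 * m * (#(cliqueTuples G s) : ℝ) ≤ (n : ℝ) ^ s)
    (hno : ∀ n, N ≤ n → ∀ G : SimpleGraph (Fin n), IsFar P ε G →
      c * (n : ℝ) ^ s ≤ #(cliqueTuples G s)) :
    IsTestable P ε := by
  classical
  set Q := N * N + m * (s * s) with hQ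
  have hQ1 : N * N ≤ Q := Nat.le_add_right _ _
  have hQ2 : m * (s * s) ≤ Q := Nat.le_add_left _ _
  refine ⟨Q, cliqueTester P s m N Q, fun n G r _ => by simp [run_cliqueTester], fun n G => ?_⟩
  rcases lt_or_ge n N with hn | hn
  · have hone : ∀ b, (b = true ↔ P n G) →
        2 / 3 ≤ (cliqueTester P s m N Q).probOutput Q G b := by
      intro b hb
      have hpos := (cliqueTester P s m N Q).numSeeds_pos n
      rw [QueryAlgorithm.probOutput, filter_true_of_mem, card_range, div_self]
      · norm_num
      · exact_mod_cast hpos.ne'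
      · exact fun r _ => (run_cliqueTester_of_lt hn hQ1 G r b).2 hb
    refine ⟨fun hP => hone true (by simpa using hP), fun hfar => hone false ?_⟩
    simp only [Bool.false_eq_true, false_iff]
    exact fun hP => not_isFar hε hP le_rfl (by simp [lostPairs]; positivity) hfar
  · have hn0 : 0 < n := hN.trans_le hn
    have hpow : (0 : ℝ) < (n : ℝ) ^ s := by positivity
    have hx1 : (#(cliqueTuples G s) : ℝ) / (n : ℝ) ^ s ≤ 1 := by
      rw [div_le_one hpow]
      have hle : #(cliqueTuples G s) ≤ n ^ s := by
        simpa using card_le_univ (cliqueTuples G s)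
      exact_mod_cast hle
    have htrue := probOutput_true_cliqueTester (P := P) hn hn0 hQ2 G
    have hsum := probOutput_false_add_true (P := P) (s := s) (m := m) (N := N) (Q := Q) G
    set x := (#(cliqueTuples G s) : ℝ) / (n : ℝ) ^ s with hx
    constructor
    · intro hP
      rw [htrue]
      have h1 : m * x ≤ 1 / 3 := by
        rw [hx, ← mul_div_assoc, div_le_iff₀ hpow]
        linarith [hyes n hn G hP]
      have h2 := one_add_mul_le_pow (a := -x) (by linarith) m
      rw [← sub_eq_add_neg] at h2
      linarith
    · intro hfar
      have h1 : c ≤ x := by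
        rw [hx, le_div_iff₀ hpow]
        exact hno n hn G hfar
      have h2 : (1 - x) ^ m ≤ (1 - c) ^ m := pow_le_pow_left₀ (by linarith) (by linarith) m
      linarith

/-! ### Testability of large Betti numbers -/

/-- Sufficiently many samples hit a set of density `c` with probability at least `2 / 3`. -/
theorem exists_samples {c : ℝ} (hc : 0 < c) :
    ∃ m : ℕ, 0 < m ∧ (1 - c) ^ m ≤ 1 / 3 := by
  obtain ⟨m, hm⟩ := exists_pow_lt_of_lt_one (show (0 : ℝ) < 1 / 3 by norm_num)
    (show 1 - c < 1 by linarith)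
  refine ⟨m, Nat.pos_of_ne_zero ?_, hm.le⟩
  rintro rfl
  norm_num at hm

/-- The property of having no clique with `s` vertices is testable. -/
theorem isTestable_of_iff_cliqueTuples_eq_empty {P : GraphProperty} {ε : ℝ} (hε : 0 < ε) {s : ℕ}
    (hP : ∀ n (G : SimpleGraph (Fin n)), P n G ↔ cliqueTuples G s = ∅) : IsTestable P ε := by
  obtain ⟨c, hc, hremoval⟩ := clique_removal.{0} s hε
  obtain ⟨m, -, hm⟩ := exists_samples hc
  refine isTestable_of_cliqueTuples hε.le (s := s) one_pos hm (fun n _ G hG => ?_) fun n _ G hfar => ?_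
  · rw [(hP n G).1 hG]
    simp
  · by_contra! hlt
    obtain ⟨G', hle, hempty, hlost⟩ := hremoval G (by simpa using hlt)
    exact not_isFar hε.le ((hP n G').2 hempty) hle (by simpa using hlost) hfar

theorem betti_le_numFaces {n : ℕ} (G : SimpleGraph (Fin n)) (k : ℕ) :
    betti (cliqueComplex G) k ≤ numFaces (cliqueComplex G) k :=
  (Nat.le_add_right _ _).trans (betti_add_finrank_boundaries_le _ k)

theorem largeBetti_of_numFaces_eq_zero {n : ℕ} {G : SimpleGraph (Fin n)} {k : ℕ} {δ : ℝ}
    (h : numFaces (cliqueComplex G) k = 0) : LargeBetti k δ n G := by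
  simp [LargeBetti, h]

theorem isTestable_largeBetti_of_neg {k : ℕ} {δ ε : ℝ} (hδ : δ < 0) (hε : 0 < ε) :
    IsTestable (LargeBetti k δ) ε := by
  refine isTestable_of_iff_cliqueTuples_eq_empty hε (s := k + 1) fun n G => ?_
  rw [← numFaces_eq_zero_iff]
  refine ⟨fun h => ?_, largeBetti_of_numFaces_eq_zero⟩
  have h1 : (betti (cliqueComplex G) k : ℝ) ≤ numFaces (cliqueComplex G) k := by
    exact_mod_cast betti_le_numFaces G k
  have h2 : (1 - δ) * (numFaces (cliqueComplex G) k : ℝ) ≤ betti (cliqueComplex G) k := h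
  have h3 : (0 : ℝ) ≤ numFaces (cliqueComplex G) k := Nat.cast_nonneg _
  have h4 : (numFaces (cliqueComplex G) k : ℝ) = 0 := by nlinarith
  exact_mod_cast h4

theorem largeBetti_zero_iff {n : ℕ} {G : SimpleGraph (Fin n)} {k : ℕ} :
    LargeBetti k 0 n G ↔ numFaces (cliqueComplex G) k ≤ betti (cliqueComplex G) k := by
  simp [LargeBetti]

/-- For `δ = 0` all `k`-chains have to be cycles and none of them a boundary. For `k = 0` this means
that there are no edges, for `k > 0` that there are no `k`-faces. -/
theorem isTestable_largeBetti_zero (k : ℕ) {ε : ℝ} (hε : 0 < ε) :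
    IsTestable (LargeBetti k 0) ε := by
  cases k with
  | zero =>
    refine isTestable_of_iff_cliqueTuples_eq_empty hε (s := 2) fun n G => ?_
    rw [← numFaces_eq_zero_iff, largeBetti_zero_iff]
    refine ⟨fun h => ?_, fun h => (betti_zero_eq _ h).ge⟩
    have h1 := numFaces_succ_add_le (cliqueComplex G) 0
    have h2 := Nat.mul_le_mul_left (Fintype.card (Fin n)) h
    simp only [zero_add] at h1 ⊢
    omega
  | succ k =>
    refine isTestable_of_iff_cliqueTuples_eq_empty hε (s := k + 2) fun n G => ?_
    rw [← numFaces_eq_zero_iff, largeBetti_zero_iff]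
    exact ⟨numFaces_succ_eq_zero_of_le_betti _ k, fun h => by rw [h]; exact Nat.zero_le _⟩

theorem card_cliqueTuples_le_of_largeBetti {n k : ℕ} {δ : ℝ} (hδ : 0 ≤ δ)
    {G : SimpleGraph (Fin n)} (h : LargeBetti k δ n G) :
    (#(cliqueTuples G (k + 2)) : ℝ) ≤ δ * (k + 2 : ℕ) ^ (k + 2) * (n : ℝ) ^ (k + 2) := by
  have h1 : (#(cliqueTuples G (k + 2)) : ℝ) ≤
      (k + 2 : ℕ) ^ (k + 2) * numFaces (cliqueComplex G) (k + 1) := by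
    exact_mod_cast card_cliqueTuples_le G (k + 1)
  have h2 : (numFaces (cliqueComplex G) (k + 1) : ℝ) + n * betti (cliqueComplex G) k ≤
      n * numFaces (cliqueComplex G) k := by
    have := numFaces_succ_add_le (cliqueComplex G) k
    rw [Fintype.card_fin] at this
    exact_mod_cast this
  have h3 : (numFaces (cliqueComplex G) k : ℝ) ≤ (n : ℝ) ^ (k + 1) := by
    have := numFaces_le (cliqueComplex G) k
    rw [Fintype.card_fin] at this
    exact_mod_cast this
  have h4 : (numFaces (cliqueComplex G) (k + 1) : ℝ) ≤ δ * (n : ℝ) ^ (k + 2) := by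
    have h5 := mul_le_mul_of_nonneg_left (show (1 - δ) * (numFaces (cliqueComplex G) k : ℝ) ≤
      betti (cliqueComplex G) k from h) (Nat.cast_nonneg n)
    calc (numFaces (cliqueComplex G) (k + 1) : ℝ)
        ≤ δ * (n * numFaces (cliqueComplex G) k) := by linarith
      _ ≤ δ * (n * (n : ℝ) ^ (k + 1)) := by gcongr
      _ = δ * (n : ℝ) ^ (k + 2) := by ring
  calc (#(cliqueTuples G (k + 2)) : ℝ)
      ≤ (k + 2 : ℕ) ^ (k + 2) * numFaces (cliqueComplex G) (k + 1) := h1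
    _ ≤ (k + 2 : ℕ) ^ (k + 2) * (δ * (n : ℝ) ^ (k + 2)) := by gcongr
    _ = _ := by ring

/-- A graph without cliques of `k + 2` vertices has the property, unless it has so few `k`-faces that
they can be removed as well. -/
theorem largeBetti_or_card_cliqueTuples_le {n k : ℕ} {δ : ℝ} (hδ : 0 < δ)
    {G : SimpleGraph (Fin n)} (h : cliqueTuples G (k + 2) = ∅) :
    LargeBetti k δ n G ∨
      δ * (#(cliqueTuples G (k + 1)) : ℝ) ≤ (k + 1 : ℕ) ^ (k + 1) * (n : ℝ) ^ k := by
  rw [or_iff_not_imp_left]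
  intro hnot
  have h1 : (numFaces (cliqueComplex G) k : ℝ) ≤ betti (cliqueComplex G) k + (n : ℝ) ^ k := by
    have := numFaces_le_betti_add (cliqueComplex G) k (numFaces_eq_zero_iff.2 h)
    rw [Fintype.card_fin] at this
    exact_mod_cast this
  have h2 : (betti (cliqueComplex G) k : ℝ) < (1 - δ) * numFaces (cliqueComplex G) k :=
    not_le.1 hnot
  have h3 : (#(cliqueTuples G (k + 1)) : ℝ) ≤
      (k + 1 : ℕ) ^ (k + 1) * numFaces (cliqueComplex G) k := by
    exact_mod_cast card_cliqueTuples_le G k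
  calc δ * (#(cliqueTuples G (k + 1)) : ℝ)
      ≤ δ * ((k + 1 : ℕ) ^ (k + 1) * numFaces (cliqueComplex G) k) := by gcongr
    _ = (k + 1 : ℕ) ^ (k + 1) * (δ * numFaces (cliqueComplex G) k) := by ring
    _ ≤ (k + 1 : ℕ) ^ (k + 1) * (n : ℝ) ^ k := by gcongr; linarith

/-- Far graphs have many cliques of `k + 2` vertices: otherwise these could be removed, and if the
resulting graph still lacked the property, its few cliques of `k + 1` vertices could be removed
too. -/
theorem exists_le_card_cliqueTuples_of_isFar (k : ℕ) {ε : ℝ} (hε : 0 < ε) :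
    ∃ c : ℝ, 0 < c ∧ ∀ δ : ℝ, 0 < δ → ∃ N : ℕ, ∀ n, N ≤ n → ∀ G : SimpleGraph (Fin n),
      IsFar (LargeBetti k δ) ε G → c * (n : ℝ) ^ (k + 2) ≤ #(cliqueTuples G (k + 2)) := by
  obtain ⟨c, hc, hremoval⟩ := clique_removal.{0} (k + 2) (half_pos hε)
  obtain ⟨c', hc', hremoval'⟩ := clique_removal.{0} (k + 1) (half_pos hε)
  refine ⟨c, hc, fun δ hδ => ?_⟩
  obtain ⟨N, hN⟩ := exists_nat_gt (((k + 1 : ℕ) : ℝ) ^ (k + 1) / (δ * c'))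
  refine ⟨max N 1, fun n hn G hfar => ?_⟩
  by_contra! hlt
  obtain ⟨G', hle, hempty, hlost⟩ := hremoval G (by simpa using hlt)
  rw [Fintype.card_fin] at hlost
  rcases largeBetti_or_card_cliqueTuples_le hδ hempty with hP | hfew
  · refine not_isFar hε.le hP hle (hlost.trans ?_) hfar
    gcongr
    linarith
  · have hn0 : (0 : ℝ) < n := by
      exact_mod_cast (le_max_right N 1).trans hn
    have hNn : (N : ℝ) ≤ n := by
      exact_mod_cast (le_max_left N 1).trans hn
    have hlt' : (#(cliqueTuples G' (k + 1)) : ℝ) < c' * (n : ℝ) ^ (k + 1) := by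
      have h1 := (div_lt_iff₀ (mul_pos hδ hc')).1 (hN.trans_le hNn)
      refine lt_of_mul_lt_mul_left (hfew.trans_lt ?_) hδ.le
      calc ((k + 1 : ℕ) : ℝ) ^ (k + 1) * (n : ℝ) ^ k < n * (δ * c') * (n : ℝ) ^ k := by gcongr
        _ = δ * (c' * (n : ℝ) ^ (k + 1)) := by ring
    obtain ⟨G'', hle', hempty', hlost'⟩ := hremoval' G' (by simpa using hlt')
    rw [Fintype.card_fin] at hlost'
    have hsum : (#(lostPairs G G'') : ℝ) ≤ #(lostPairs G G') + #(lostPairs G' G'') := by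
      exact_mod_cast card_lostPairs_le_add G G' G''
    exact not_isFar hε.le (largeBetti_of_numFaces_eq_zero (numFaces_eq_zero_iff.2 hempty'))
      (hle'.trans hle) (by linarith) hfar

end BettiTesting

theorem theorem3 (k : ℕ) (ε : ℝ) (hε : 0 < ε) :
    ∃ δ₀ : ℝ, 0 < δ₀ ∧ ∀ δ : ℝ, δ ≤ δ₀ →
      BettiTesting.IsTestable (BettiTesting.LargeBetti k δ) ε := by
  obtain ⟨c, hc, hfar⟩ := BettiTesting.exists_le_card_cliqueTuples_of_isFar k hε
  obtain ⟨m, hm0, hm⟩ := BettiTesting.exists_samples hc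
  have hm0' : (0 : ℝ) < m := by exact_mod_cast hm0
  -- The number `m` of samples depends on `c` only, so `δ₀` may be chosen after it: on graphs with the
  -- property the `m` samples then find a clique with probability at most `1 / 3`.
  refine ⟨1 / (3 * m * (k + 2 : ℕ) ^ (k + 2)), by positivity, fun δ hδ => ?_⟩
  rcases lt_trichotomy δ 0 with hδ0 | rfl | hδ0
  · exact BettiTesting.isTestable_largeBetti_of_neg hδ0 hε
  · exact BettiTesting.isTestable_largeBetti_zero k hε
  obtain ⟨N, hN⟩ := hfar δ hδ0
  refine BettiTesting.isTestable_of_cliqueTuples hε.le (s := k + 2) (N := N + 1) N.succ_pos hm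
    (fun n _ G hP => ?_) fun n hn => hN n (by omega)
  have h1 := BettiTesting.card_cliqueTuples_le_of_largeBetti hδ0.le hP
  have h2 : δ * (3 * m * (k + 2 : ℕ) ^ (k + 2)) ≤ 1 := (le_div_iff₀ (by positivity)).1 hδ
  calc 3 * m * ((BettiTesting.cliqueTuples G (k + 2)).card : ℝ)
      ≤ 3 * m * (δ * (k + 2 : ℕ) ^ (k + 2) * (n : ℝ) ^ (k + 2)) := by gcongr
    _ = δ * (3 * m * (k + 2 : ℕ) ^ (k + 2)) * (n : ℝ) ^ (k + 2) := by ring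
    _ ≤ 1 * (n : ℝ) ^ (k + 2) := by gcongr
    _ = (n : ℝ) ^ (k + 2) := one_mul _
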